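/- Let $\mathbb{F}_{q^m}/\mathbb{F}_q$ be an extension of finite fields of degree $m$, let $\theta(x)=x^q$ be the $q$-Frobenius automorphism of $\mathbb{F}_{q^m}$, and write $\mathrm{Tr}$ for the trace of $\mathbb{F}_{q^m}/\mathbb{F}_q$ and $\mathrm{rk}_q(v)$ for the $\mathbb{F}_q$-dimension of the span of the entries of a vector $v$ over $\mathbb{F}_{q^m}$. For an integer $s$ coprime to $m$, a generalized Gabidulin code of dimension $k$, length $n$ and parameter $s$ is a code of the form $$\mathcal G_{k,s}(g)=\Big\{\big(f(g_1),\ldots,f(g_n)\big) \;\Big|\; f(x)=\sum_{i=0}^{k-1} f_i\,\theta^{si}(x),\ f_0,\ldots,f_{k-1}\in\mathbb{F}_{q^m}\Big\},$$ where $g=(g_1,\ldots,g_n)\in\mathbb{F}_{q^m}^n$ satisfies $\mathrm{rk}_q(g)=n$. For $X\in\mathbb{F}_{q^m}^{k\times(n-k)}$, let $\mathcal C_X\subseteq\mathbb{F}_{q^m}^n$ be the row space of $(I_k\mid X)$. A matrix $A$ is Toeplitz if its entries $A_{i,j}$ depend only on $j-i$. **Theorem.** Let $0<k<n\le m$ be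 integers and let $s$ be an integer coprime to $m$. Then there exists a Toeplitz matrix $X\in\mathbb{F}_{q^m}^{k\times(n-k)}$ such that $\mathcal C_X$ is a generalized Gabidulin code of parameter $s$. More precisely, let $\gamma$ be any primitive element of $\mathbb{F}_{q^m}$ (a generator of $\mathbb{F}_{q^m}^*$). Then there is an integer $\ell\ge 0$ such that the vectors $$\alpha=(\gamma^{\ell+n-k-1},\gamma^{\ell+n-k},\ldots,\gamma^{\ell+n-2}),\qquad \beta=(1,\gamma^{-1},\ldots,\gamma^{-(n-k-1)})$$ satisfy $\mathrm{rk}_q(\alpha)=k$, $\mathrm{rk}_q(\beta)=n-k$ and $\mathrm{Tr}(\alpha_i\beta_j)=0$ for all $i,j$, and such that the following holds for every $\delta\in\mathbb{F}_{q^m}$ with $\mathrm{Tr}(\delta)\ne0$ and every Toeplitz matrix $B\in\mathbb{F}_q^{k\times(n-k)}$. Put $\sigma=\theta^s$ and $$\pi_s(x)=\frac{-1}{\mathrm{Tr}(\delta)}\sum_{i=0}^{m-2}\Big(\sigma^{i+1}(\delta)\sum_{j=0}^{i}\sigma^j(x)\Big).$$ Then the matrix $X=\big(\pi_s(\alpha_i\beta_j)+B_{i,j}\big)_{i,j}$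 is Toeplitz and $\mathcal C_X$ is a generalized Gabidulin code of parameter $s$. -/

import Mathlib

open scoped BigOperators

noncomputable section

namespace RankMetric

/-- A matrix `A` is a Toeplitz matrix if `A i j = a (j - i)` for some family `a`. (Only the values
of `a` at `1 - r, …, t - 1` matter, where `A` is of size `r × t`.) -/
def IsToeplitz {F : Type*} {r t : ℕ} (A : Matrix (Fin r) (Fin t) F) : Prop :=
  ∃ a : ℤ → F, ∀ (i : Fin r) (j : Fin t), A i j = a ((j : ℤ) - (i : ℤ))

/-- The matrix `(I_k | X)` of size `k × n`. -/
def standardForm {L : Type*} [Field L] {k n : ℕ} (X : Matrix (Fin k) (Fin (n - k)) L) :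
    Matrix (Fin k) (Fin n) L :=
  Matrix.of fun i j =>
    if h : (j : ℕ) < k then (1 : Matrix (Fin k) (Fin k) L) i ⟨j, h⟩
    else X i ⟨(j : ℕ) - k, by have := j.isLt; omega⟩

/-- The code `C_X`: the `L`-subspace of `L ^ n` spanned by the rows of `(I_k | X)`. -/
def systematicCode {L : Type*} [Field L] {k n : ℕ} (X : Matrix (Fin k) (Fin (n - k)) L) :
    Submodule L (Fin n → L) :=
  Submodule.span L (Set.range fun i : Fin k => standardForm X i)

section Extension

variable (K : Type*) {L : Type*} [Field K] [Fintype K] [Field L] [Finite L] [Algebra K L]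

/-- The support over `K` of a vector with entries in `L`: the `K`-span of the entries. -/
def supp {r : ℕ} (v : Fin r → L) : Submodule K L :=
  Submodule.span K (Set.range v)

/-- The `q`-rank of a vector with entries in `L`: the `K`-dimension of its support. -/
def qRank {r : ℕ} (v : Fin r → L) : ℕ :=
  Module.finrank K (supp K v)

variable (L) in
/-- The automorphism `θ ^ s` of `L`, where `θ : x ↦ x ^ q` is the `q`-Frobenius automorphism,
`q = |K|`, and `s` is an integer. -/
def frobPow (s : ℤ) : L ≃ₐ[K] L :=
  (FiniteField.frobeniusAlgEquivOfAlgebraic K L) ^ s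

theorem frobPow_natCast_apply (s : ℕ) (x : L) :
    frobPow K L (s : ℤ) x = x ^ (Fintype.card K ^ s) := by
  rw [frobPow, zpow_natCast, AlgEquiv.coe_pow,
    FiniteField.coe_frobeniusAlgEquivOfAlgebraic_iterate]

variable (L) in
/-- The set `G_{k,s}` of linearized polynomials
`f_0 x + f_1 x ^ [s] + ⋯ + f_{k-1} x ^ [s(k-1)]` with coefficients in `L`, where
`x ^ [i] = x ^ (q ^ i) = θ ^ i x`. Linearized polynomials are taken modulo `x ^ (q ^ m) - x`,
that is, as functions on `L`. -/
def linearizedPolys (k : ℕ) (s : ℤ) : Set (L → L) :=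
  {f | ∃ c : Fin k → L, f = fun x => ∑ i : Fin k, c i * frobPow K L (s * (i : ℤ)) x}

/-- The evaluation code `{(f(g_1), …, f(g_n)) | f ∈ G_{k,s}}`. -/
def evalCode (k : ℕ) {n : ℕ} (s : ℤ) (g : Fin n → L) : Set (Fin n → L) :=
  {v | ∃ f ∈ linearizedPolys K L k s, v = fun j => f (g j)}

/-- `C` is a generalized Gabidulin code `G_{k,s}(g)` of parameter `s`, for some vector `g` of
`q`-rank `n`. -/
def IsGenGabidulin (k : ℕ) {n : ℕ} (s : ℤ) (C : Submodule L (Fin n → L)) : Prop :=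
  ∃ g : Fin n → L, qRank K g = n ∧ (C : Set (Fin n → L)) = evalCode K k s g

/-- The trace-orthogonal space `S^×` of a `K`-subspace `S` of `L`. -/
def traceOrthogonal (S : Submodule K L) : Submodule K L :=
  (Algebra.traceForm K L).orthogonal S

/-- The admissibility conditions on the defining vectors `α`, `β` of a `(q,s)`-Cauchy matrix. -/
def IsCauchyPair {t r : ℕ} (α : Fin t → L) (β : Fin r → L) : Prop :=
  qRank K α = t ∧ qRank K β = r ∧ supp K β ≤ traceOrthogonal K (supp K α)

/-- The map
`π_s(x) = - Tr(δ)⁻¹ ∑_{i=0}^{m-2} σ^{i+1}(δ) ∑_{j=0}^{i} σ^j(x)`, with `σ = θ ^ s`,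
`m = [L : K]` and a fixed `δ ∈ L` (of nonzero trace). -/
def cauchyPi (s : ℤ) (δ x : L) : L :=
  -(algebraMap K L (Algebra.trace K L δ))⁻¹ *
    ∑ i ∈ Finset.range (Module.finrank K L - 1),
      frobPow K L (s * ((i : ℤ) + 1)) δ *
        ∑ j ∈ Finset.range (i + 1), frobPow K L (s * (j : ℤ)) x

/-- The matrix `C_{(q,s)}(α, β, B)` with entries `π_s(α_i β_j) + B_{i,j}`, where `B` has entries
in `K`. -/
def cauchyMatrix (s : ℤ) (δ : L) {t r : ℕ} (α : Fin t → L) (β : Fin r → L)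
    (B : Matrix (Fin t) (Fin r) K) : Matrix (Fin t) (Fin r) L :=
  Matrix.of fun i j => cauchyPi K s δ (α i * β j) + algebraMap K L (B i j)

end Extension

/-- The vector `(γ^{ℓ+n-k-1}, γ^{ℓ+n-k}, …, γ^{ℓ+n-2})` of length `k`. -/
def toeplitzAlpha {L : Type*} [Field L] (γ : Lˣ) (ℓ k n : ℕ) : Fin k → L :=
  fun i => (γ : L) ^ (ℓ + (n - k - 1) + (i : ℕ))

/-- The vector `(1, γ^{-1}, …, γ^{-(n-k-1)})` of length `n - k`. -/
def toeplitzBeta {L : Type*} [Field L] (γ : Lˣ) (k n : ℕ) : Fin (n - k) → L :=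
  fun j => ((γ : L) ^ (j : ℕ))⁻¹

end RankMetric

end

/-! Put σ = θ^s. Since s is coprime to m, σ generates the Galois group, so its fixed field is `K`
and the trace is the sum of its powers. When Tr(x) = 0, additive Hilbert 90 says that y = π_s(x)
solves σ(y) - y = x (`frobPow_cauchyPi`); as `B` is fixed by σ, this gives σ(X) - X = αβᵀ.

Such an X yields a Gabidulin code (`systematicCode_eq_span`). Choose u ≠ 0 orthogonal to σ⁻¹α, …,
σ^{-(k-1)}α and let g = uᵀ(I | X). For r < k the rank-one corrections in σ^r(g) cancel, leaving
σ^r(u)ᵀ(I | X), which lies in C_X. The entries of g are independent over `K`, so by Moore matrices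
these k vectors are independent and span C_X.

For the Toeplitz form, α_i β_j is a power of γ depending only on j - i, with exponent between ℓ and
ℓ+n-2. The vanishing of these n-1 < m traces is a linear system in γ^ℓ with a nonzero solution, and
every nonzero element is a power of γ. -/

namespace RankMetric

/-! ### Moore matrices -/

section Moore

variable {K L : Type*} [Field K] [Field L] [Algebra K L]

/-- Columns of a Moore matrix: if `v` is linearly independent over the fixed field `K` of `σ`, the
vectors `(v j, σ (v j), …, σ ^ (t - 1) (v j))`, for `j` in a set of size `t`, are linearly
independent over `L`. -/
theorem moore_columns_independent {σ : L ≃ₐ[K] L}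
    (hfix : ∀ x, σ x = x → ∃ c : K, algebraMap K L c = x) {ι : Type*} [DecidableEq ι]
    {v : ι → L} (hv : LinearIndependent K v) (t : Finset ι) :
    ∀ d : ι → L, (∀ r < t.card, ∑ j ∈ t, d j * (σ ^ r) (v j) = 0) → ∀ j ∈ t, d j = 0 := by
  induction t using Finset.induction_on with
  | empty => simp
  | insert a t ha ih =>
    intro d hd
    rw [Finset.card_insert_of_notMem ha] at hd
    by_cases hda : d a = 0
    · have h0 : ∀ j ∈ t, d j = 0 := ih d fun r hr => by
        have := hd r (by omega)
        rwa [Finset.sum_insert ha, hda, zero_mul, zero_add] at this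
      intro j hj
      rcases Finset.mem_insert.1 hj with rfl | hj
      exacts [hda, h0 j hj]
    exfalso
    set e : ι → L := fun j => d j / d a with he
    have hea : e a = 1 := div_self hda
    have heq : ∀ r < t.card + 1, (σ ^ r) (v a) + ∑ j ∈ t, e j * (σ ^ r) (v j) = 0 := by
      intro r hr
      have := hd r hr
      rw [Finset.sum_insert ha] at this
      have h2 : (σ ^ r) (v a) + ∑ j ∈ t, e j * (σ ^ r) (v j) =
          (d a)⁻¹ * (d a * (σ ^ r) (v a) + ∑ j ∈ t, d j * (σ ^ r) (v j)) := by
        rw [mul_add, inv_mul_cancel_left₀ hda, Finset.mul_sum]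
        congr 1
        exact Finset.sum_congr rfl fun j _ => by simp only [he]; ring
      rw [h2, this, mul_zero]
    -- Applying σ⁻¹ to relation r+1 and subtracting it from relation r cancels the normalised term
    -- at `a`, leaving a relation over `t` alone. The coefficients `e j` are thus fixed by σ and lie
    -- in `K`.
    have hfixed : ∀ j ∈ t, e j - σ.symm (e j) = 0 := by
      refine ih _ fun r hr => ?_
      have h1 := heq r (by omega)
      have h2 := congrArg σ.symm (heq (r + 1) (by omega))
      have h3 : ∀ x, σ.symm ((σ ^ (r + 1)) x) = (σ ^ r) x := fun x => by
        rw [pow_succ', AlgEquiv.mul_apply, AlgEquiv.symm_apply_apply]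
      simp only [map_add, map_sum, map_mul, map_zero, h3] at h2
      simp only [sub_mul, Finset.sum_sub_distrib]
      linear_combination h1 - h2
    have hmem : ∀ j, ∃ c : K, j ∈ insert a t → algebraMap K L c = e j := by
      intro j
      by_cases hj : j ∈ insert a t
      · have : σ (e j) = e j := by
          rcases Finset.mem_insert.1 hj with rfl | hj
          · rw [hea, map_one]
          · have := sub_eq_zero.1 (hfixed j hj)
            rw [eq_comm, AlgEquiv.symm_apply_eq] at this
            exact this.symm
        obtain ⟨c, hc⟩ := hfix _ this
        exact ⟨c, fun _ => hc⟩
      · exact ⟨0, fun h => absurd h hj⟩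
    choose c hc using hmem
    have hsum : ∑ j ∈ insert a t, c j • v j = 0 := by
      rw [← heq 0 (by omega), Finset.sum_insert ha]
      congr 1
      · rw [Algebra.smul_def, hc a (Finset.mem_insert_self _ _), hea]; simp
      · refine Finset.sum_congr rfl fun j hj => ?_
        rw [Algebra.smul_def, hc j (Finset.mem_insert_of_mem hj)]; simp
    have hca := linearIndependent_iff'.1 hv _ c hsum a (Finset.mem_insert_self _ _)
    have := hc a (Finset.mem_insert_self _ _)
    rw [hca, map_zero, hea] at this
    exact zero_ne_one this

/-- The square Moore matrix of a `K`-independent vector is invertible. -/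
theorem isUnit_moore {σ : L ≃ₐ[K] L}
    (hfix : ∀ x, σ x = x → ∃ c : K, algebraMap K L c = x) {k : ℕ} {v : Fin k → L}
    (hv : LinearIndependent K v) :
    IsUnit (Matrix.of fun i j : Fin k => (σ ^ (i : ℕ)) (v j)) := by
  rw [← Matrix.mulVec_injective_iff_isUnit]
  rw [← Matrix.coe_mulVecLin, ← LinearMap.ker_eq_bot, LinearMap.ker_eq_bot']
  intro d hd
  funext j
  refine moore_columns_independent hfix hv Finset.univ d (fun r hr => ?_) j (Finset.mem_univ _)
  have := congrFun hd ⟨r, by simpa using hr⟩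
  simpa [Matrix.mulVec, dotProduct, mul_comm] using this

/-- Rows of a Moore matrix with at least as many columns as rows are linearly independent. -/
theorem moore_rows_independent {σ : L ≃ₐ[K] L}
    (hfix : ∀ x, σ x = x → ∃ c : K, algebraMap K L c = x) {k n : ℕ} (hkn : k ≤ n)
    {v : Fin n → L} (hv : LinearIndependent K v) {c : Fin k → L}
    (hc : ∀ j, ∑ i, c i * (σ ^ (i : ℕ)) (v j) = 0) : c = 0 := by
  have hu := isUnit_moore hfix (hv.comp (Fin.castLE hkn) (Fin.castLE_injective hkn))
  apply Matrix.vecMul_injective_iff_isUnit.2 hu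
  funext j
  simpa [Matrix.vecMul, dotProduct] using hc (Fin.castLE hkn j)

end Moore

/-! ### From σ(X) - X = αβᵀ to a Gabidulin generator -/

section Construction

variable {K L : Type*} [Field K] [Field L] [Algebra K L]

/-- There is `u` orthogonal to `σ⁻¹ α, …, σ^{-(k-1)} α`, and the only `y` orthogonal to `u`
with `σ y - y` a multiple of `α` is `0`. -/
theorem exists_dual_vector {σ : L ≃ₐ[K] L}
    (hfix : ∀ x, σ x = x → ∃ c : K, algebraMap K L c = x) {k : ℕ} (hk : 0 < k) {α : Fin k → L}
    (hα : LinearIndependent K α) :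
    ∃ u : Fin k → L, (∀ r, 0 < r → r < k → ∑ i, u i * (σ.symm ^ r) (α i) = 0) ∧
      ∀ (y : Fin k → L) (l : L), (∑ i, u i * y i = 0) → (∀ i, σ (y i) = y i + α i * l) →
        l = 0 ∧ y = 0 := by
  have hfix' : ∀ x, σ.symm x = x → ∃ c : K, algebraMap K L c = x := fun x hx =>
    hfix x ((AlgEquiv.symm_apply_eq _).1 hx).symm
  set A : Matrix (Fin k) (Fin k) L := Matrix.of fun i j => (σ.symm ^ (i : ℕ)) (α j) with hA
  have hAu : IsUnit A := isUnit_moore hfix' hα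
  have hdet : IsUnit A.det := (Matrix.isUnit_iff_isUnit_det A).1 hAu
  set o : Fin k := ⟨0, hk⟩
  set u : Fin k → L := A⁻¹.mulVec (Pi.single o 1) with hu
  have hAu1 : A.mulVec u = Pi.single o 1 := by
    rw [hu, Matrix.mulVec_mulVec, Matrix.mul_nonsing_inv _ hdet, Matrix.one_mulVec]
  refine ⟨u, fun r hr hrk => ?_, fun y l hy hσ => ?_⟩
  · have := congrFun hAu1 ⟨r, hrk⟩
    rw [Pi.single_eq_of_ne (by simp [o, Fin.ext_iff]; omega)] at this
    rw [← this]
    exact Finset.sum_congr rfl fun i _ => mul_comm _ _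
  · set d : Fin k → L := Matrix.vecMul y A⁻¹ with hd
    have hdA : Matrix.vecMul d A = y := by
      rw [hd, Matrix.vecMul_vecMul, Matrix.nonsing_inv_mul _ hdet, Matrix.vecMul_one]
    have hd0 : d o = 0 := by
      have : d ⬝ᵥ A.mulVec u = 0 := by
        rw [Matrix.dotProduct_mulVec, hdA, ← hy]
        exact Finset.sum_congr rfl fun i _ => mul_comm _ _
      rwa [hAu1, dotProduct_single, mul_one] at this
    -- Coordinates of `y` in the basis σ^{-i}α. Extension by zero gives `e k = 0`, the start of the
    -- descending recursion; `e 0 = 0` is the condition u·y = 0.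
    set e : ℕ → L := fun i => if h : i < k then d ⟨i, h⟩ else 0 with he
    have hed : ∀ i : Fin k, e i = d i := fun i => by simp [he]
    have he0 : e 0 = 0 := by simpa [he, hk] using hd0
    have hek : e k = 0 := by simp [he]
    have hy' : ∀ j, y j = ∑ i ∈ Finset.range k, e i * (σ.symm ^ i) (α j) := fun j => by
      rw [← hdA, Finset.sum_range]
      simp [Matrix.vecMul, dotProduct, hA, hed]
    -- Since σ lowers the index in σ^{-i}α by one, comparing coordinates in σ(y) = y + lα gives this
    -- recursion.
    have hz : (fun i : Fin k => σ (e (i + 1)) - e i - if (i : ℕ) = 0 then l else 0) = 0 := by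
      refine moore_rows_independent hfix' le_rfl hα fun j => ?_
      have h1 := hσ j
      rw [hy' j, map_sum] at h1
      have h2 : ∑ i ∈ Finset.range k, σ (e i * (σ.symm ^ i) (α j)) =
          ∑ i ∈ Finset.range k, σ (e (i + 1)) * (σ.symm ^ i) (α j) := by
        have h3 := Finset.sum_range_succ' (fun i => σ (e i * (σ.symm ^ i) (α j))) k
        rw [Finset.sum_range_succ, hek, he0] at h3
        simp only [zero_mul, map_zero, add_zero] at h3
        rw [h3]
        refine Finset.sum_congr rfl fun i _ => ?_
        rw [map_mul, pow_succ', AlgEquiv.mul_apply, AlgEquiv.apply_symm_apply]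
      rw [h2] at h1
      simp only [sub_mul, Finset.sum_sub_distrib]
      rw [← Finset.sum_range (fun i => σ (e (i + 1)) * (σ.symm ^ i) (α j)), h1,
        ← Finset.sum_range (fun i => e i * (σ.symm ^ i) (α j)),
        ← Finset.sum_range (fun i => (if i = 0 then l else 0) * (σ.symm ^ i) (α j))]
      simp only [ite_mul, zero_mul, Finset.sum_ite_eq', Finset.mem_range, hk, if_true, pow_zero,
        AlgEquiv.one_apply]
      ring
    have hrec : ∀ i < k, σ (e (i + 1)) - e i - (if i = 0 then l else 0) = 0 := fun i hi =>
      congrFun hz ⟨i, hi⟩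
    have hzero : ∀ i, 1 ≤ i → i ≤ k → e i = 0 := by
      intro i h1 hik
      induction hik using Nat.decreasingInduction with
      | self => exact hek
      | of_succ i hi ih =>
        have := hrec i hi
        rw [ih (by omega), if_neg (by omega), map_zero] at this
        linear_combination -this
    refine ⟨?_, ?_⟩
    · have := hrec 0 hk
      rw [hzero _ le_rfl hk, he0, map_zero, if_pos rfl] at this
      linear_combination -this
    · funext j
      rw [hy' j]
      refine Finset.sum_eq_zero fun i hi => ?_
      rcases Nat.eq_zero_or_pos i with rfl | hi0
      · rw [he0, zero_mul]
      · rw [hzero i hi0 (Finset.mem_range.1 hi).le, zero_mul]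

theorem standardForm_of_lt {k n : ℕ} (X : Matrix (Fin k) (Fin (n - k)) L) (i : Fin k)
    (j : Fin n) (h : (j : ℕ) < k) :
    standardForm X i j = if (i : ℕ) = j then 1 else 0 := by
  simp [standardForm, h, Matrix.one_apply, Fin.ext_iff]

theorem standardForm_of_ge {k n : ℕ} (X : Matrix (Fin k) (Fin (n - k)) L) (i : Fin k)
    (j : Fin n) (h : ¬ (j : ℕ) < k) :
    standardForm X i j = X i ⟨(j : ℕ) - k, by have := j.isLt; omega⟩ := by
  simp [standardForm, h]

/-- If `σ X - X = α βᵀ` then the code generated by `(I | X)` is spanned by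
`g, σ g, …, σ ^ (k - 1) g` for some `g` with `K`-independent entries. -/
theorem systematicCode_eq_span {σ : L ≃ₐ[K] L}
    (hfix : ∀ x, σ x = x → ∃ c : K, algebraMap K L c = x) {k n : ℕ} (hk : 0 < k) (hkn : k ≤ n)
    {α : Fin k → L} {β : Fin (n - k) → L} (hα : LinearIndependent K α)
    (hβ : LinearIndependent K β) {X : Matrix (Fin k) (Fin (n - k)) L}
    (hX : ∀ i j, σ (X i j) = X i j + α i * β j) :
    ∃ g : Fin n → L, LinearIndependent K g ∧
      Submodule.span L (Set.range fun r : Fin k => fun j => (σ ^ (r : ℕ)) (g j)) =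
        systematicCode X := by
  obtain ⟨u, hu, huniq⟩ := exists_dual_vector hfix hk hα
  set G := standardForm X with hG
  set b : Fin n → L := fun j => if h : (j : ℕ) < k then 0
    else β ⟨(j : ℕ) - k, by have := j.isLt; omega⟩ with hb
  have hGσ : ∀ i j, σ (G i j) = G i j + α i * b j := by
    intro i j
    by_cases h : (j : ℕ) < k
    · rw [hG, standardForm_of_lt X i j h]
      simp only [hb, h, dif_pos]
      split_ifs <;> simp
    · rw [hG, standardForm_of_ge X i j h, hX]
      simp only [hb, h, dif_neg, not_false_iff]
  have hGpow : ∀ (r : ℕ) i j,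
      (σ ^ r) (G i j) = G i j + ∑ l ∈ Finset.range r, (σ ^ l) (α i) * (σ ^ l) (b j) := by
    intro r i j
    induction r with
    | zero => simp
    | succ r ih =>
      rw [pow_succ, AlgEquiv.mul_apply, hGσ, map_add, ih, map_mul, Finset.sum_range_succ, add_assoc]
  set g : Fin n → L := fun j => ∑ i, u i * G i j with hg
  have hgind : LinearIndependent K g := by
    rw [Fintype.linearIndependent_iff]
    intro a ha
    have hbsum : ∀ l : Fin n → L, (∑ j, b j * l j) =
        ∑ j : Fin (n - k), β j * l ⟨k + j, by omega⟩ := by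
      intro l
      have hkn' : k + (n - k) = n := by omega
      rw [← (finCongr hkn').sum_comp, Fin.sum_univ_add]
      simp [hb]
      rfl
    -- For a relation `a` over `K` on the entries of `g`, the vector y = Ga satisfies u·y = 0 and
    -- σ(y) = y + α(b·a). Hence b·a = 0, which kills the last n-k entries of `a` by independence of
    -- β; then Ga = 0 kills the others through the identity block.
    obtain ⟨hl, hy⟩ := huniq (fun i => ∑ j, G i j * algebraMap K L (a j))
      (∑ j, b j * algebraMap K L (a j)) (by
        rw [← ha]
        simp only [hg, Algebra.smul_def, Finset.mul_sum]
        rw [Finset.sum_comm]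
        exact Finset.sum_congr rfl fun _ _ => Finset.sum_congr rfl fun _ _ => by ring) (by
        intro i
        simp only [map_sum, map_mul, AlgEquiv.commutes, hGσ, Finset.mul_sum,
          ← Finset.sum_add_distrib]
        exact Finset.sum_congr rfl fun _ _ => by ring)
    have hge : ∀ j : Fin n, ¬ (j : ℕ) < k → a j = 0 := by
      intro j hj
      rw [hbsum] at hl
      have := Fintype.linearIndependent_iff.1 hβ (fun j => a ⟨k + j, by omega⟩)
        (by rw [← hl]; exact Finset.sum_congr rfl fun _ _ => by rw [Algebra.smul_def, mul_comm])
        ⟨j - k, by omega⟩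
      convert this using 2
      ext
      simp
      omega
    intro j
    by_cases hj : (j : ℕ) < k
    · have := congrFun hy ⟨j, hj⟩
      simp only [Pi.zero_apply] at this
      rw [Finset.sum_eq_single j] at this
      · rw [hG, standardForm_of_lt X _ _ hj] at this
        simpa using this
      · intro j' _ hne
        by_cases hj' : (j' : ℕ) < k
        · rw [hG, standardForm_of_lt X _ _ hj', if_neg, zero_mul]
          exact fun h => hne (Fin.ext h.symm)
        · rw [hge _ hj', map_zero, mul_zero]
      · simp
    · exact hge j hj
  refine ⟨g, hgind, ?_⟩
  apply Submodule.eq_of_le_of_finrank_le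
  · rw [Submodule.span_le]
    rintro _ ⟨r, rfl⟩
    have : (fun j => (σ ^ (r : ℕ)) (g j)) = ∑ i, (σ ^ (r : ℕ)) (u i) • G i := by
      funext j
      simp only [hg, map_sum, map_mul, hGpow, Finset.sum_apply, Pi.smul_apply, smul_eq_mul, mul_add,
        Finset.sum_add_distrib, Finset.mul_sum]
      rw [Finset.sum_comm, add_eq_left]
      refine Finset.sum_eq_zero fun l hl => ?_
      rw [Finset.mem_range] at hl
      -- Here 0 < r - l < k, so σ^r(u)·σ^l(α) = σ^r(u·σ^{-(r-l)}α) = 0.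
      have h0 := congrArg (σ ^ (r : ℕ)) (hu (r - l) (by omega) (by omega))
      have h1 : ∀ x, (σ ^ (r : ℕ)) ((σ.symm ^ ((r : ℕ) - l)) x) = (σ ^ l) x := by
        intro x
        obtain ⟨t, ht⟩ : ∃ t, (r : ℕ) = l + t := ⟨r - l, by omega⟩
        rw [ht, add_tsub_cancel_left, pow_add, AlgEquiv.mul_apply, ← AlgEquiv.mul_apply (σ ^ t),
          show σ.symm = σ⁻¹ from rfl, inv_pow, mul_inv_cancel, AlgEquiv.one_apply]
      simp only [map_sum, map_mul, map_zero, h1] at h0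
      simp only [← mul_assoc]
      rw [← Finset.sum_mul, h0, zero_mul]
    change (fun j => (σ ^ (r : ℕ)) (g j)) ∈ systematicCode X
    rw [this]
    exact Submodule.sum_mem _ fun i _ => Submodule.smul_mem _ _ (Submodule.subset_span ⟨i, rfl⟩)
  · rw [finrank_span_eq_card]
    · exact finrank_range_le_card _
    · rw [Fintype.linearIndependent_iff]
      intro c hc
      refine congrFun (moore_rows_independent hfix hkn hgind fun j => ?_)
      simpa using congrFun hc j

end Construction

end RankMetric

namespace RankMetric

/-! ### The generator σ = θ^s and additive Hilbert 90 -/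

section Frobenius

variable (K : Type*) {L : Type*} [Field K] [Fintype K] [Field L] [Finite L] [Algebra K L]

variable (L) in
theorem frobPow_mul_natCast (s : ℤ) (i : ℕ) : frobPow K L (s * i) = frobPow K L s ^ i := by
  rw [frobPow, frobPow, zpow_mul, zpow_natCast]

-- A Bézout relation as + bm = 1 gives θ = σ^a, because θ has order m.
variable (L) in
theorem zpowers_frobPow {s : ℤ} (hs : IsCoprime s (Module.finrank K L : ℤ)) :
    Subgroup.zpowers (frobPow K L s) = ⊤ := by
  rw [eq_top_iff]
  intro f _
  obtain ⟨⟨i, hi⟩, hif⟩ := (FiniteField.bijective_frobeniusAlgEquivOfAlgebraic_pow K L).2 f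
  obtain ⟨a, b, hab⟩ := hs
  have h1 : FiniteField.frobeniusAlgEquivOfAlgebraic K L = frobPow K L s ^ a := by
    rw [frobPow, ← zpow_mul, mul_comm]
    conv_lhs => rw [← zpow_one (FiniteField.frobeniusAlgEquivOfAlgebraic K L), ← hab]
    rw [zpow_add, mul_comm b, zpow_mul _ (Module.finrank K L : ℤ), zpow_natCast,
      ← FiniteField.orderOf_frobeniusAlgEquivOfAlgebraic K L, pow_orderOf_eq_one, one_zpow, mul_one]
  rw [← hif]
  simp only [h1]
  exact Subgroup.pow_mem _ (Subgroup.zpow_mem _ (Subgroup.mem_zpowers _) _) _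

theorem mem_range_of_frobPow_eq {s : ℤ} (hs : IsCoprime s (Module.finrank K L : ℤ)) (x : L)
    (hx : frobPow K L s x = x) : ∃ c : K, algebraMap K L c = x := by
  have h : x ∈ (⊥ : IntermediateField K L) := by
    rw [IsGalois.mem_bot_iff_fixed]
    intro f
    have hf : f ∈ Subgroup.zpowers (frobPow K L s) := by
      rw [zpowers_frobPow K L hs]; exact Subgroup.mem_top f
    have hle : Subgroup.zpowers (frobPow K L s) ≤ MulAction.stabilizer Gal(L/K) x := by
      rw [Subgroup.zpowers_le]
      exact hx
    exact hle hf
  exact IntermediateField.mem_bot.1 h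

theorem trace_eq_sum_frobPow {s : ℤ} (hs : IsCoprime s (Module.finrank K L : ℤ)) (x : L) :
    algebraMap K L (Algebra.trace K L x) =
      ∑ i ∈ Finset.range (Module.finrank K L), (frobPow K L s ^ i) x := by
  have hord : orderOf (frobPow K L s) = Module.finrank K L := by
    rw [orderOf_eq_card_of_forall_mem_zpowers, IsGalois.card_aut_eq_finrank]
    intro f
    rw [zpowers_frobPow K L hs]
    exact Subgroup.mem_top f
  have hinj : Function.Injective
      fun i : Fin (Module.finrank K L) => frobPow K L s ^ (i : ℕ) := by
    intro i j hij
    exact Fin.ext (pow_injOn_Iio_orderOf (by simp [hord]) (by simp [hord]) hij)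
  have hbij : Function.Bijective
      fun i : Fin (Module.finrank K L) => frobPow K L s ^ (i : ℕ) := by
    rw [Fintype.bijective_iff_injective_and_card]
    refine ⟨hinj, ?_⟩
    rw [Fintype.card_fin, ← IsGalois.card_aut_eq_finrank K L, Nat.card_eq_fintype_card]
  rw [trace_eq_sum_automorphisms, ← hbij.sum_comp, Finset.sum_range]

theorem cauchyPi_eq (s : ℤ) (δ x : L) :
    cauchyPi K s δ x = -(algebraMap K L (Algebra.trace K L δ))⁻¹ *
      ∑ i ∈ Finset.range (Module.finrank K L - 1), (frobPow K L s ^ (i + 1)) δ *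
        ∑ j ∈ Finset.range (i + 1), (frobPow K L s ^ j) x := by
  simp only [cauchyPi, frobPow_mul_natCast]
  congr 1
  refine Finset.sum_congr rfl fun i _ => ?_
  rw [← frobPow_mul_natCast]
  push_cast
  rfl

/-- The map `π_s` solves the equation `σ y - y = x` of the additive Hilbert 90 theorem. -/
theorem frobPow_cauchyPi {s : ℤ} (hs : IsCoprime s (Module.finrank K L : ℤ)) {δ x : L}
    (hδ : Algebra.trace K L δ ≠ 0) (hx : Algebra.trace K L x = 0) :
    frobPow K L s (cauchyPi K s δ x) = cauchyPi K s δ x + x := by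
  have hT : algebraMap K L (Algebra.trace K L δ) ≠ 0 := by simpa using hδ
  have hTδ := trace_eq_sum_frobPow K hs δ
  have hTx := trace_eq_sum_frobPow K hs x
  rw [hx, map_zero] at hTx
  rw [cauchyPi_eq, map_mul, map_neg, map_inv₀, AlgEquiv.commutes]
  set T := algebraMap K L (Algebra.trace K L δ)
  set σ := frobPow K L s
  obtain ⟨N, hN⟩ : ∃ N, Module.finrank K L = N + 1 :=
    ⟨_, (Nat.succ_pred_eq_of_pos Module.finrank_pos).symm⟩
  rw [hN] at hTδ hTx ⊢
  rw [Nat.add_sub_cancel]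
  set S : ℕ → L := fun i => ∑ j ∈ Finset.range i, (σ ^ j) x with hS
  have hσpow : ∀ (j : ℕ) y, σ ((σ ^ j) y) = (σ ^ (j + 1)) y := fun j y => by
    rw [pow_succ', AlgEquiv.mul_apply]
  have hσS : ∀ i, σ (S i) = S (i + 1) - x := fun i => by
    simp only [hS, map_sum, hσpow, Finset.sum_range_succ' _ i, pow_zero, AlgEquiv.one_apply,
      add_sub_cancel_right]
  have hσN : (σ ^ (N + 1)) δ = δ := by
    have h : σ ^ (N + 1) = 1 := by
      rw [← hN, ← IsGalois.card_aut_eq_finrank K L, pow_card_eq_one']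
    rw [h, AlgEquiv.one_apply]
  -- Because σ(S_i) = S_{i+1} - x, applying σ shifts the sum by one index. The new end term vanishes
  -- since S_m = Tr(x) = 0, and the lost first term σ(δ)x completes x·Tr(δ).
  have hmain : σ (∑ i ∈ Finset.range N, (σ ^ (i + 1)) δ * S (i + 1)) =
      ∑ i ∈ Finset.range N, (σ ^ (i + 1)) δ * S (i + 1) - x * T := by
    have h1 : σ (∑ i ∈ Finset.range N, (σ ^ (i + 1)) δ * S (i + 1)) =
        ∑ i ∈ Finset.range N, ((σ ^ (i + 1 + 1)) δ * S (i + 1 + 1) - x * (σ ^ (i + 1 + 1)) δ) := by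
      rw [map_sum]
      refine Finset.sum_congr rfl fun i _ => ?_
      rw [map_mul, hσpow, hσS]
      ring
    have h2 := Finset.sum_range_succ' (fun i => (σ ^ (i + 1)) δ * S (i + 1)) N
    have hSN : S (N + 1) = 0 := hTx.symm
    have hS1 : S (0 + 1) = x := by simp [hS]
    rw [Finset.sum_range_succ, hSN, hS1, mul_zero, add_zero] at h2
    have h3 : T = ∑ i ∈ Finset.range N, (σ ^ (i + 1 + 1)) δ + (σ ^ (0 + 1)) δ := by
      rw [← Finset.sum_range_succ' (fun i => (σ ^ (i + 1)) δ) N, Finset.sum_range_succ, hσN,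
        hTδ, Finset.sum_range_succ' _ N, pow_zero, AlgEquiv.one_apply]
    rw [h1, Finset.sum_sub_distrib, ← Finset.mul_sum, h2, h3]
    ring
  rw [hmain]
  field_simp
  ring

theorem isGenGabidulin_of_eq_span {s : ℤ} {k n : ℕ} {C : Submodule L (Fin n → L)} {g : Fin n → L}
    (hg : LinearIndependent K g)
    (hC : Submodule.span L
      (Set.range fun r : Fin k => fun j => (frobPow K L s ^ (r : ℕ)) (g j)) = C) :
    IsGenGabidulin K k s C := by
  refine ⟨g, ?_, ?_⟩
  · rw [qRank, supp, finrank_span_eq_card hg, Fintype.card_fin]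
  · ext v
    rw [SetLike.mem_coe, ← hC, Submodule.mem_span_range_iff_exists_fun]
    simp only [evalCode, linearizedPolys, Set.mem_ofPred_eq, frobPow_mul_natCast]
    constructor
    · rintro ⟨c, rfl⟩
      exact ⟨_, ⟨c, rfl⟩, by funext j; simp⟩
    · rintro ⟨_, ⟨c, rfl⟩, rfl⟩
      exact ⟨c, by funext j; simp⟩

omit [Finite L] in
theorem linearIndependent_of_qRank_eq {r : ℕ} {v : Fin r → L} (hv : qRank K v = r) :
    LinearIndependent K v := by
  rw [linearIndependent_iff_card_eq_finrank_span, Fintype.card_fin]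
  exact hv.symm

omit [Fintype K] [Finite L] in
theorem IsCauchyPair.trace_mul_eq_zero {t r : ℕ} {α : Fin t → L} {β : Fin r → L}
    (h : IsCauchyPair K α β) (i : Fin t) (j : Fin r) : Algebra.trace K L (α i * β j) = 0 :=
  h.2.2 (Submodule.subset_span ⟨j, rfl⟩) _ (Submodule.subset_span ⟨i, rfl⟩)

/-- A `(q, s)`-Cauchy matrix generates a generalized Gabidulin code. -/
theorem IsCauchyPair.isGenGabidulin {s : ℤ} (hs : IsCoprime s (Module.finrank K L : ℤ)) {k n : ℕ}
    (hk : 0 < k) (hkn : k ≤ n) {α : Fin k → L} {β : Fin (n - k) → L} (h : IsCauchyPair K α β)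
    {δ : L} (hδ : Algebra.trace K L δ ≠ 0) (B : Matrix (Fin k) (Fin (n - k)) K) :
    IsGenGabidulin K k s (systematicCode (cauchyMatrix K s δ α β B)) := by
  obtain ⟨g, hg, hC⟩ := systematicCode_eq_span (mem_range_of_frobPow_eq K hs) hk hkn
    (linearIndependent_of_qRank_eq K h.1) (linearIndependent_of_qRank_eq K h.2.1)
    (X := cauchyMatrix K s δ α β B) fun i j => by
      simp only [cauchyMatrix, Matrix.of_apply, map_add, AlgEquiv.commutes,
        frobPow_cauchyPi K hs hδ (h.trace_mul_eq_zero K i j)]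
      ring
  exact isGenGabidulin_of_eq_span K hg hC

end Frobenius

/-! ### Geometric progressions in γ -/

section Toeplitz

theorem toeplitzAlpha_mul_toeplitzBeta {L : Type*} [Field L] (γ : Lˣ) (ℓ : ℕ) {k n : ℕ}
    (i : Fin k) (j : Fin (n - k)) :
    toeplitzAlpha γ ℓ k n i * toeplitzBeta γ k n j =
      (γ : L) ^ (((ℓ + (n - k - 1) : ℕ) : ℤ) - ((j : ℤ) - (i : ℤ))) := by
  have h : (γ : L) ≠ 0 := γ.ne_zero
  rw [toeplitzAlpha, toeplitzBeta, ← zpow_natCast, ← zpow_natCast, ← zpow_neg, ← zpow_add₀ h]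
  congr 1
  push_cast
  ring

variable (K : Type*) {L : Type*} [Field K] [Fintype K] [Field L] [Finite L] [Algebra K L]

theorem isToeplitz_cauchyMatrix (s : ℤ) (δ : L) (γ : Lˣ) (ℓ : ℕ) {k n : ℕ}
    {B : Matrix (Fin k) (Fin (n - k)) K} (hB : IsToeplitz B) :
    IsToeplitz (cauchyMatrix K s δ (toeplitzAlpha γ ℓ k n) (toeplitzBeta γ k n) B) := by
  obtain ⟨b, hb⟩ := hB
  refine ⟨fun d => cauchyPi K s δ ((γ : L) ^ (((ℓ + (n - k - 1) : ℕ) : ℤ) - d)) +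
    algebraMap K L (b d), fun i j => ?_⟩
  rw [cauchyMatrix, Matrix.of_apply, toeplitzAlpha_mul_toeplitzBeta, hb]

-- Every nonzero element is a power of γ, so γ generates `L` as a field and its minimal polynomial
-- has degree m.
omit [Fintype K] in
theorem linearIndependent_pow_of_generator {γ : Lˣ} (hγ : Subgroup.zpowers γ = ⊤) {r : ℕ}
    (hr : r ≤ Module.finrank K L) : LinearIndependent K fun i : Fin r => (γ : L) ^ (i : ℕ) := by
  have htop : IntermediateField.adjoin K {(γ : L)} = ⊤ := by
    rw [eq_top_iff]
    intro x _
    rcases eq_or_ne x 0 with rfl | hx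
    · exact zero_mem _
    · obtain ⟨i, hi⟩ := Subgroup.mem_zpowers_iff.1
        (show Units.mk0 x hx ∈ Subgroup.zpowers γ by rw [hγ]; exact Subgroup.mem_top _)
      have : x = (γ : L) ^ i := by
        rw [← Units.val_zpow_eq_zpow_val, hi, Units.val_mk0]
      rw [this]
      exact zpow_mem (IntermediateField.mem_adjoin_simple_self K _) i
  have hdeg : (minpoly K (γ : L)).natDegree = Module.finrank K L := by
    rw [← IntermediateField.adjoin.finrank (IsIntegral.of_finite K _), htop,
      IntermediateField.finrank_top']
  exact (linearIndependent_pow (K := K) (γ : L)).comp (Fin.castLE (hr.trans hdeg.ge))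
    (Fin.castLE_injective _)

omit [Fintype K] [Finite L] in
theorem linearIndependent_mul_left {r : ℕ} {v : Fin r → L} (hv : LinearIndependent K v) {c : L}
    (hc : c ≠ 0) : LinearIndependent K fun i => c * v i :=
  hv.map' (LinearMap.mulLeft K c) (LinearMap.ker_eq_bot.2 (mul_right_injective₀ hc))

omit [Fintype K] in
theorem exists_trace_pow_mul_pow_eq_zero {γ : Lˣ} (hγ : Subgroup.zpowers γ = ⊤) {r : ℕ}
    (hr : r < Module.finrank K L) :
    ∃ ℓ : ℕ, ∀ e < r, Algebra.trace K L ((γ : L) ^ (ℓ + e)) = 0 := by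
  -- Fewer than m trace conditions leave a nonzero kernel vector; finiteness of the unit group makes
  -- it a power of γ with natural exponent.
  let f : L →ₗ[K] (Fin r → K) := LinearMap.pi fun e =>
    (Algebra.trace K L).comp (LinearMap.mulRight K ((γ : L) ^ (e : ℕ)))
  have hf : f.ker ≠ ⊥ := LinearMap.ker_ne_bot_of_finrank_lt (by simpa using hr)
  obtain ⟨x, hxf, hx⟩ := Submodule.exists_mem_ne_zero_of_ne_bot hf
  have hmem : Units.mk0 x hx ∈ Submonoid.powers γ := by
    rw [mem_powers_iff_mem_zpowers, hγ]
    exact Subgroup.mem_top _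
  obtain ⟨ℓ, hℓ⟩ := hmem
  refine ⟨ℓ, fun e he => ?_⟩
  have h1 := congrFun (LinearMap.mem_ker.1 hxf) ⟨e, he⟩
  have h2 : (γ : L) ^ ℓ = x := by
    simpa using congrArg Units.val hℓ
  rw [pow_add, h2]
  exact h1

omit [Fintype K] in
theorem isCauchyPair_toeplitz {γ : Lˣ} (hγ : Subgroup.zpowers γ = ⊤) {k n ℓ : ℕ} (hkn : k < n)
    (hn : n ≤ Module.finrank K L)
    (hℓ : ∀ e < n - 1, Algebra.trace K L ((γ : L) ^ (ℓ + e)) = 0) :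
    IsCauchyPair K (toeplitzAlpha γ ℓ k n) (toeplitzBeta γ k n) := by
  have h0 : (γ : L) ≠ 0 := γ.ne_zero
  refine ⟨?_, ?_, ?_⟩
  · have hα : LinearIndependent K (toeplitzAlpha γ ℓ k n) := by
      convert linearIndependent_mul_left K
        (linearIndependent_pow_of_generator K hγ (hkn.le.trans hn))
        (pow_ne_zero (ℓ + (n - k - 1)) h0) using 2 with i
      rw [toeplitzAlpha, pow_add _ (ℓ + (n - k - 1))]
    rw [qRank, supp, finrank_span_eq_card hα, Fintype.card_fin]
  · have hγ' : Subgroup.zpowers γ⁻¹ = ⊤ := by rw [Subgroup.zpowers_inv, hγ]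
    have hβ : LinearIndependent K (toeplitzBeta γ k n) := by
      convert linearIndependent_pow_of_generator K hγ' (r := n - k) (by omega) using 2 with j
      rw [toeplitzBeta, Units.val_inv_eq_inv_val, inv_pow]
    rw [qRank, supp, finrank_span_eq_card hβ, Fintype.card_fin]
  · rw [supp, Submodule.span_le]
    rintro _ ⟨j, rfl⟩ x hx
    have hle : supp K (toeplitzAlpha γ ℓ k n) ≤
        LinearMap.ker ((Algebra.trace K L).comp
          (LinearMap.mulRight K (toeplitzBeta γ k n j))) := by
      rw [supp, Submodule.span_le]
      rintro _ ⟨i, rfl⟩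
      rw [SetLike.mem_coe, LinearMap.mem_ker, LinearMap.comp_apply, LinearMap.mulRight_apply,
        toeplitzAlpha_mul_toeplitzBeta]
      have hi := i.isLt
      have hj := j.isLt
      -- The offset n-k-1 in α keeps this exponent nonnegative; it is at most n-2.
      rw [← hℓ (n - k - 1 - j + i) (by omega), ← zpow_natCast]
      congr 2
      omega
    exact hle hx

end Toeplitz

end RankMetric

theorem mainTheorem6 {K L : Type*} [Field K] [Fintype K] [Field L] [Finite L] [Algebra K L]
    (k n m : ℕ) (hm : Module.finrank K L = m) (hk : 0 < k) (hkn : k < n) (hnm : n ≤ m)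
    (s : ℤ) (hs : IsCoprime s (m : ℤ)) :
    (∃ X : Matrix (Fin k) (Fin (n - k)) L,
      RankMetric.IsToeplitz X ∧
        RankMetric.IsGenGabidulin K k s (RankMetric.systematicCode X)) ∧
    (∀ γ : Lˣ, Subgroup.zpowers γ = ⊤ →
      ∃ ℓ : ℕ,
        RankMetric.IsCauchyPair K
          (RankMetric.toeplitzAlpha γ ℓ k n) (RankMetric.toeplitzBeta γ k n) ∧
        ∀ δ : L, Algebra.trace K L δ ≠ 0 →
          ∀ B : Matrix (Fin k) (Fin (n - k)) K, RankMetric.IsToeplitz B →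
            RankMetric.IsToeplitz (RankMetric.cauchyMatrix K s δ
              (RankMetric.toeplitzAlpha γ ℓ k n) (RankMetric.toeplitzBeta γ k n) B) ∧
            RankMetric.IsGenGabidulin K k s (RankMetric.systematicCode
              (RankMetric.cauchyMatrix K s δ
                (RankMetric.toeplitzAlpha γ ℓ k n) (RankMetric.toeplitzBeta γ k n) B))) := by

  subst hm
  have hmain : ∀ γ : Lˣ, Subgroup.zpowers γ = ⊤ → ∃ ℓ : ℕ,
      RankMetric.IsCauchyPair K
        (RankMetric.toeplitzAlpha γ ℓ k n) (RankMetric.toeplitzBeta γ k n) ∧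
      ∀ δ : L, Algebra.trace K L δ ≠ 0 →
        ∀ B : Matrix (Fin k) (Fin (n - k)) K, RankMetric.IsToeplitz B →
          RankMetric.IsToeplitz (RankMetric.cauchyMatrix K s δ
            (RankMetric.toeplitzAlpha γ ℓ k n) (RankMetric.toeplitzBeta γ k n) B) ∧
          RankMetric.IsGenGabidulin K k s (RankMetric.systematicCode
            (RankMetric.cauchyMatrix K s δ
              (RankMetric.toeplitzAlpha γ ℓ k n) (RankMetric.toeplitzBeta γ k n) B)) := by
    intro γ hγ
    obtain ⟨ℓ, hℓ⟩ := RankMetric.exists_trace_pow_mul_pow_eq_zero K hγ (r := n - 1) (by omega)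
    have hpair := RankMetric.isCauchyPair_toeplitz K hγ hkn hnm hℓ
    exact ⟨ℓ, hpair, fun δ hδ B hB => ⟨RankMetric.isToeplitz_cauchyMatrix K s δ γ ℓ hB,
      hpair.isGenGabidulin K hs hk hkn.le hδ B⟩⟩
  refine ⟨?_, hmain⟩
  obtain ⟨γ, hγ⟩ := IsCyclic.exists_generator (α := Lˣ)
  obtain ⟨ℓ, -, h⟩ := hmain γ ((Subgroup.eq_top_iff' _).2 hγ)
  obtain ⟨δ, hδ⟩ := Algebra.trace_surjective K L 1
  exact ⟨_, h δ (by rw [hδ]; exact one_ne_zero) 0 ⟨0, fun _ _ => rfl⟩⟩
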